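/- Let $A$ be a unital C$^*$-algebra and $D=\{z\in A:\|z\|<1\}$. On the right $A$-module $A^2$ let $\theta(x,y)=x_1^*y_1-x_2^*y_2$, and let $U(\theta)\subset GL_2(A)$ be the group of invertible matrices preserving $\theta$; it acts on $D$ by $g\cdot z=(g_{21}+g_{22}z)(g_{11}+g_{12}z)^{-1}$. For $z\in D$ let $\ell_z=\{(1,z)a:a\in A\}\subset A^2$, let $q_z\in M_2(A)$ be the $\theta$-orthogonal projection onto $\ell_z$, $q_z(y)=(1,z)(1-z^*z)^{-1}\theta((1,z),y)$, and let $\varepsilon_z=2q_z-1$ be the corresponding reflection. A *normalized basis* of $\ell_z$ is an $x\in\ell_z$ with $\theta(x,x)=1$ and $x_1$ invertible. Let $\Gamma_z$ be the algebra of right $A$-module endomorphisms of $\ell_z$, with the C$^*$-structure obtained from $A$ by identifying $\varphi\in\Gamma_z$ with its matrix $a$, $\varphi(x)=xa$, in a normalized basis $x$ (another normalized basis $xu$, $u$ unitary, replaces $a$ by $u^*au$). For a matrix $V$ tangent at $q_z$ to $\{q_w : w\in D\}$, or at $\varepsilon_z$ to $\{\varepsilon_w : w\in D\}$, let $\langle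 V,V\rangle_z\in\Gamma_z$ be the endomorphism with matrix $-\theta(Vx,Vx)$, let $\mathrm{mod}_z(V)=\langle V,V\rangle_z^{1/2}$ be the *$\theta$-modulus* of $V$, and let $\|V\|_z=\|\theta(Vx,Vx)\|^{1/2}$. The geodesics from $z_0\in D$ are the curves $\delta(t)=e^{tX}\cdot z_0$, where $X\in M_2(A)$ is $\theta$-antisymmetric and co-diagonal with respect to $q_{z_0}$ (that is, $q_{z_0}Xq_{z_0}=0=(1-q_{z_0})X(1-q_{z_0})$). Define $cr(0,z)\in\Gamma_z$ by $cr(0,z)\big((1,z)a\big)=(1,z)(1+|z|)(1-|z|)^{-1}a$, and for $z_0\ne z_1$ in $D$ put $cr(z_0,z_1)=g\,cr(0,g^{-1}\cdot z_1)\,g^{-1}\in\Gamma_{z_1}$ for any $g\in U(\theta)$ with $g\cdot 0=z_0$. **Theorem.** Let $z_0\neq z_1$ in $D$. There is exactly one such $X$ with $e^{X}\cdot z_0=z_1$; the endomorphism $cr(z_0,z_1)$ exists and does not depend on the choice of $g$; its parallel transport $cr(z_0,z_1)_{z_0}=e^{-X}cr(z_0,z_1)e^{X}$ is a well defined endomorphism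 of $\ell_{z_0}$; and $\ell_{z_0}$ has a normalized basis. Let $\mathrm{Log}_{z_0}(z_1)$ be the initial velocity at $t=0$ of the geodesic $\delta(t)=e^{tX}\cdot z_0$ from $z_0$ to $z_1$, regarded as the matrix $\frac{d}{dt}\big|_{0}\,q_{\delta(t)}$. Then $\langle\mathrm{Log}_{z_0}(z_1),\mathrm{Log}_{z_0}(z_1)\rangle_{z_0}$ is positive, $cr(z_0,z_1)_{z_0}$ is positive and invertible in $\Gamma_{z_0}$, and, for every normalized basis of $\ell_{z_0}$, $$\mathrm{mod}_{z_0}\big(\mathrm{Log}_{z_0}(z_1)\big)=\tfrac12\log\big(cr(z_0,z_1)_{z_0}\big),\qquad \|\mathrm{Log}_{z_0}(z_1)\|_{z_0}=\tfrac12\big\|\log\big(cr(z_0,z_1)_{z_0}\big)\big\|.$$ Equivalently, if the same tangent vector is represented in the model of reflections, by the matrix $\frac{d}{dt}\big|_{0}\,\varepsilon_{\delta(t)}$, the two formulas hold without the factors $\frac12$. -/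

import Mathlib

namespace PoincareDisk

/-- The right `A`-module `A²`; the scalar `a` acts on the right, as `MulOpposite.op a`. -/
abbrev Vec (A : Type*) := Fin 2 → A

/-- The algebra `M₂(A)`, acting on `A²` from the left through `Matrix.mulVec`. -/
abbrev Mat (A : Type*) := Matrix (Fin 2) (Fin 2) A

/-- The open unit disk of `A`. -/
def disk (A : Type*) [CStarAlgebra A] : Set A := {z | ‖z‖ < 1}

/-- The signed form `θ(x, y) = x₁* y₁ - x₂* y₂`. -/
def theta {A : Type*} [CStarAlgebra A] (x y : Vec A) : A :=
  star (x 0) * y 0 - star (x 1) * y 1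

/-- Membership in the group `U(θ)` of invertible matrices that preserve `θ`. -/
def IsThetaUnitary {A : Type*} [CStarAlgebra A] (g : (Mat A)ˣ) : Prop :=
  ∀ x y : Vec A, theta ((g : Mat A).mulVec x) ((g : Mat A).mulVec y) = theta x y

/-- The action on the disk, `g · z = (g₂₁ + g₂₂ z)(g₁₁ + g₁₂ z)⁻¹`. -/
noncomputable def act {A : Type*} [CStarAlgebra A] (g : Mat A) (z : A) : A :=
  (g 1 0 + g 1 1 * z) * Ring.inverse (g 0 0 + g 0 1 * z)

/-- The point `ℓ_z = [(1, z)] = {(1, z) a : a ∈ A}` of the projective line. -/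
def line {A : Type*} [CStarAlgebra A] (z : A) : Submodule Aᵐᵒᵖ (Vec A) :=
  Submodule.span Aᵐᵒᵖ {![1, z]}

/-- The `θ`-orthogonal projection `q_z` onto `ℓ_z`, namely
`y ↦ (1, z) (1 - z* z)⁻¹ θ((1, z), y)`. -/
noncomputable def proj {A : Type*} [CStarAlgebra A] (z : A) : Mat A :=
  !![Ring.inverse (1 - star z * z), -(Ring.inverse (1 - star z * z) * star z);
     z * Ring.inverse (1 - star z * z), -(z * Ring.inverse (1 - star z * z) * star z)]

/-- The reflection `ε_z = 2 q_z - 1` that corresponds to the projection `q_z`. -/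
noncomputable def refl {A : Type*} [CStarAlgebra A] (z : A) : Mat A :=
  2 * proj z - 1

/-- The horizontal space at `z` of the reductive structure of the homogeneous space
`D ≃ U(θ) / (isotropy group)`: the elements of the Lie algebra of `U(θ)` (the
`θ`-antisymmetric matrices) that are co-diagonal with respect to `q_z`.
At `z = 0` these are the matrices with rows `(0, α*)` and `(α, 0)`. -/
def IsHorizontal {A : Type*} [CStarAlgebra A] (z : A) (X : Mat A) : Prop :=
  (∀ x y : Vec A, theta (X.mulVec x) y + theta x (X.mulVec y) = 0) ∧
    proj z * X * proj z = 0 ∧ (1 - proj z) * X * (1 - proj z) = 0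

/-- The geodesic `t ↦ exp(t X) · z` of the reductive connection. -/
noncomputable def geodesic {A : Type*} [CStarAlgebra A] (z : A) (X : Mat A) (t : ℝ) : A :=
  act (NormedSpace.exp (t • X)) z

/-- `X` is horizontal at `z₀`, and the geodesic from `z₀` that it determines is at `z₁` at
time `1`. -/
def Joins {A : Type*} [CStarAlgebra A] (z₀ z₁ : A) (X : Mat A) : Prop :=
  IsHorizontal z₀ X ∧ geodesic z₀ X 1 = z₁

/-- The endomorphism `cr(0, z)` of `ℓ_z`: `(1, z) a ↦ (1, z) (1 + |z|)(1 - |z|)⁻¹ a`.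
The coordinate `a` of the vector `y = (1, z) a` is `y 0`. -/
noncomputable def crZero {A : Type*} [CStarAlgebra A] [PartialOrder A] [StarOrderedRing A]
    (z : A) : Module.End Aᵐᵒᵖ (line z) where
  toFun y := ⟨MulOpposite.op
      ((1 + CFC.abs z) * Ring.inverse (1 - CFC.abs z) * (y : Vec A) 0) • ![1, z],
    Submodule.smul_mem _ _ (Submodule.subset_span rfl)⟩
  map_add' y y' := by
    ext1
    simp only [Submodule.coe_add, Pi.add_apply, mul_add, MulOpposite.op_add, add_smul]
  map_smul' b y := by
    ext1
    simp only [RingHom.id_apply, Submodule.coe_smul, Pi.smul_apply, smul_smul]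
    congr 1
    apply MulOpposite.unop_injective
    simp [mul_assoc]

/-- `φ` is the cross ratio `cr(z₀, z₁) = g cr(0, z) g⁻¹`, an endomorphism of `ℓ_{z₁}`,
where `g ∈ U(θ)`, `g · 0 = z₀` and `z = g⁻¹ · z₁`. -/
def IsCrossRatio {A : Type*} [CStarAlgebra A] [PartialOrder A] [StarOrderedRing A]
    (z₀ z₁ : A) (φ : Module.End Aᵐᵒᵖ (line z₁)) : Prop :=
  ∃ g : (Mat A)ˣ, IsThetaUnitary g ∧ act (g : Mat A) 0 = z₀ ∧
    ∀ y : line (act ((g⁻¹ : (Mat A)ˣ) : Mat A) z₁), ∃ y₁ : line z₁,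
      (y₁ : Vec A) = (g : Mat A).mulVec y ∧
      (φ y₁ : Vec A) = (g : Mat A).mulVec (crZero _ y)

/-- `ψ = e^{-X} φ e^{X}` is the parallel transport to `ℓ_{z₀}` of the endomorphism `φ` of
`ℓ_{z₁}`, along the geodesic `t ↦ exp(t X) · z₀`. -/
def IsTransport {A : Type*} [CStarAlgebra A] {z₀ z₁ : A} (X : Mat A)
    (φ : Module.End Aᵐᵒᵖ (line z₁)) (ψ : Module.End Aᵐᵒᵖ (line z₀)) : Prop :=
  ∀ y : line z₀, ∃ y₁ : line z₁,
    (y₁ : Vec A) = (NormedSpace.exp X).mulVec y ∧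
    (φ y₁ : Vec A) = (NormedSpace.exp X).mulVec (ψ y)

/-- `x` is a normalized basis of `ℓ_z`: an element of `ℓ_z` in the hyperboloid `K_θ`, i.e.
`θ(x, x) = 1` and `x₁` is invertible. -/
def IsNormalized {A : Type*} [CStarAlgebra A] {z : A} (x : line z) : Prop :=
  theta (x : Vec A) x = 1 ∧ IsUnit ((x : Vec A) 0)

/-- The matrix `a` of an endomorphism `φ` of `ℓ_z` in a normalized basis `x`: since
`θ(x, x) = 1`, the equality `φ x = x a` gives `a = θ(x, φ x)`. -/
def matrixOf {A : Type*} [CStarAlgebra A] {z : A} (x : line z)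
    (φ : Module.End Aᵐᵒᵖ (line z)) : A :=
  theta (x : Vec A) (φ x)

/-- The endomorphism of `ℓ_z` with matrix `a` in the normalized basis `x`: it maps
`y = x λ`, where `λ = θ(x, y)`, to `x a λ`. -/
def endOf {A : Type*} [CStarAlgebra A] {z : A} (x : line z) (a : A) :
    Module.End Aᵐᵒᵖ (line z) where
  toFun y := MulOpposite.op (a * theta (x : Vec A) y) • x
  map_add' y y' := by
    rw [← add_smul, ← MulOpposite.op_add, ← mul_add]
    congr 3
    simp only [theta, Submodule.coe_add, Pi.add_apply]
    noncomm_ring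
  map_smul' b y := by
    rw [RingHom.id_apply, smul_smul]
    congr 1
    apply MulOpposite.unop_injective
    simp [theta, mul_assoc, sub_mul]

/-! The fibre `Γ_z` of the coefficient bundle is the algebra of endomorphisms of `ℓ_z`, with the
C*-structure that it receives from `A` through the matrix in a normalized basis `x`. -/

/-- The logarithm in `Γ_z`. -/
noncomputable def logEnd {A : Type*} [CStarAlgebra A] {z : A} (x : line z)
    (φ : Module.End Aᵐᵒᵖ (line z)) : Module.End Aᵐᵒᵖ (line z) :=
  endOf x (CFC.log (matrixOf x φ))

/-- The positive square root in `Γ_z`. -/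
noncomputable def sqrtEnd {A : Type*} [CStarAlgebra A] [PartialOrder A] [StarOrderedRing A]
    {z : A} (x : line z) (φ : Module.End Aᵐᵒᵖ (line z)) : Module.End Aᵐᵒᵖ (line z) :=
  endOf x (CFC.sqrt (matrixOf x φ))

/-- The norm of `Γ_z`. -/
noncomputable def normEnd {A : Type*} [CStarAlgebra A] {z : A} (x : line z)
    (φ : Module.End Aᵐᵒᵖ (line z)) : ℝ :=
  ‖matrixOf x φ‖

/-- The `Γ_z`-valued product `⟨V, W⟩_z` of tangent matrices, with matrix `-θ(V x, W x)` in the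
normalized basis `x`. -/
def innerEnd {A : Type*} [CStarAlgebra A] {z : A} (x : line z) (V W : Mat A) :
    Module.End Aᵐᵒᵖ (line z) :=
  endOf x (-theta (V.mulVec x) (W.mulVec x))

/-- The `θ`-modulus `⟨V, V⟩_z^{1/2}`. -/
noncomputable def modulus {A : Type*} [CStarAlgebra A] [PartialOrder A] [StarOrderedRing A]
    {z : A} (x : line z) (V : Mat A) : Module.End Aᵐᵒᵖ (line z) :=
  sqrtEnd x (innerEnd x V V)

/-- The Finsler norm `‖θ(V x, V x)‖^{1/2}` of a tangent matrix at `z`, for a normalized basis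
`x` of `ℓ_z`. -/
noncomputable def finslerNorm {A : Type*} [CStarAlgebra A] {z : A} (x : line z) (V : Mat A) : ℝ :=
  Real.sqrt ‖theta (V.mulVec x) (V.mulVec x)‖

end PoincareDisk

/-! `U(θ)` acts transitively on the disk, and lines, projections, geodesics, cross ratios and
transport are equivariant, so everything reduces to the base point `0`. There a horizontal matrix is
`codiag α`, and splitting its exponential series into even and odd powers gives `e^{codiag α}(1, 0)
= (cosh |α|, α sinh |α| / |α|)` (`exp_codiag_mulVec`). Hence the endpoint is `z = α tanh |α| / |α|`,
its modulus is `|z| = tanh |α|`, and `(1 + |z|)(1 - |z|)⁻¹ = e^{2|α|}`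
(`crossRatio_geodesic_codiag`). The logarithm of the cross ratio is thus twice the modulus of the
velocity. It also recovers `|α|`, hence `α`, from `z`, which gives unique geodesics
(`codiag_unique`, `exists_codiag`).

Transport preserves the matrix `e^{2|α|}`: the vector `(1, 0)` is carried to `(1, z) cosh |α|`, and
`cosh |α|` commutes with `e^{2|α|}`. A general normalized basis of `ℓ_{z₀}` is `g(1, 0)u` with `u`
unitary, which conjugates both sides by `u` (`crossRatio_transportEquiv_apply`). The result is
expressed by `θ(Xx, Xx)` alone, so it does not depend on `g`.

The functions `cosh |α|` and `sinh |α| / |α|` are written as power series in `α*α`; this makes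
division by `|α|` and polar decompositions unnecessary. -/

namespace PoincareDisk

open NormedSpace
open scoped Matrix

variable {A : Type*} [CStarAlgebra A]

/-! ### The `θ`-adjoint, the group `U(θ)` and matrix exponentials. -/

/-- The adjoint of a matrix with respect to `theta`. -/
def thetaAdj (g : Mat A) : Mat A :=
  !![star (g 0 0), -star (g 1 0); -star (g 0 1), star (g 1 1)]

theorem theta_mulVec_left (g : Mat A) (x y : Vec A) :
    theta (g.mulVec x) y = theta x ((thetaAdj g).mulVec y) := by
  simp [theta, thetaAdj, Matrix.mulVec, dotProduct, Fin.sum_univ_two]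
  noncomm_ring

theorem theta_left_ext {y y' : Vec A} (h : ∀ x, theta x y = theta x y') : y = y' := by
  have h0 := h ![1, 0]
  have h1 := h ![0, 1]
  simp [theta] at h0 h1
  ext i; fin_cases i <;> simp [h0, h1]

theorem mat_ext_mulVec {g h : Mat A} (H : ∀ x : Vec A, g.mulVec x = h.mulVec x) : g = h :=
  Matrix.ext_of_mulVec_single fun _ => H _

theorem isThetaUnitary_iff (g : (Mat A)ˣ) :
    IsThetaUnitary g ↔ thetaAdj (g : Mat A) * g = 1 := by
  constructor
  · intro h
    refine mat_ext_mulVec fun y => theta_left_ext fun x => ?_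
    rw [← Matrix.mulVec_mulVec, ← theta_mulVec_left, h, Matrix.one_mulVec]
  · intro h x y
    rw [theta_mulVec_left, Matrix.mulVec_mulVec, h, Matrix.one_mulVec]

theorem theta_antisymm_iff (X : Mat A) :
    (∀ x y : Vec A, theta (X.mulVec x) y + theta x (X.mulVec y) = 0) ↔ thetaAdj X = -X := by
  have key (x y : Vec A) : theta (X.mulVec x) y + theta x (X.mulVec y)
      = theta x ((thetaAdj X + X).mulVec y) := by
    rw [theta_mulVec_left, Matrix.add_mulVec]
    simp only [theta, Pi.add_apply]
    noncomm_ring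
  simp_rw [key, eq_neg_iff_add_eq_zero]
  constructor
  · intro h
    refine mat_ext_mulVec fun y => theta_left_ext fun x => ?_
    rw [h]; simp [theta]
  · intro h x y
    rw [h]; simp [theta]

/-- The signature matrix `diag(1, -1)`, as a unit. -/
def sig : (Mat A)ˣ where
  val := !![1, 0; 0, -1]
  inv := !![1, 0; 0, -1]
  val_inv := by simp [Matrix.one_fin_two]
  inv_val := by simp [Matrix.one_fin_two]

/-- Being a similarity applied to the conjugate transpose, the `θ`-adjoint commutes with `exp`. -/
theorem thetaAdj_eq (g : Mat A) :
    thetaAdj g = ((sig : (Mat A)ˣ) : Mat A) * gᴴ * ((sig⁻¹ : (Mat A)ˣ) : Mat A) := by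
  ext i j
  fin_cases i <;> fin_cases j <;>
    simp [thetaAdj, sig, Matrix.mul_apply, Fin.sum_univ_two, Units.inv_mk, Matrix.vecMul,
      dotProduct]

theorem matrix_exp_units_conj (g : (Mat A)ˣ) (X : Mat A) :
    exp ((g : Mat A) * X * ((g⁻¹ : (Mat A)ˣ) : Mat A)) =
      (g : Mat A) * exp X * ((g⁻¹ : (Mat A)ˣ) : Mat A) := by
  let _ : NormedAlgebra ℚ A := NormedAlgebra.restrictScalars ℚ ℝ A
  exact Matrix.exp_units_conj g X

theorem thetaAdj_exp (X : Mat A) : thetaAdj (exp X) = exp (thetaAdj X) := by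
  rw [thetaAdj_eq, thetaAdj_eq, matrix_exp_units_conj, Matrix.exp_conjTranspose]

theorem exp_mul_exp_neg_mat (X : Mat A) : exp X * exp (-X) = 1 := by
  let _ : NormedAlgebra ℚ A := NormedAlgebra.restrictScalars ℚ ℝ A
  rw [← Matrix.exp_add_of_commute _ _ (Commute.refl X).neg_right, add_neg_cancel, exp_zero]

theorem hasDerivAt_exp_conj {B : Type*} [NormedRing B] [NormedAlgebra ℝ B] [CompleteSpace B]
    (X q : B) :
    HasDerivAt (fun t : ℝ => exp (t • X) * q * exp (-(t • X))) (X * q - q * X) 0 := by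
  have h (Y : B) : HasDerivAt (fun t : ℝ => exp (t • Y)) Y 0 := by
    simpa using hasDerivAt_exp_smul_const (𝕂 := ℝ) Y 0
  have h2 := h (-X)
  simp only [smul_neg] at h2
  convert ((h X).mul_const q).mul h2 using 1
  · rfl
  · simp [sub_eq_add_neg]

-- The statements about `exp` and derivatives in `Mat A` mention no norm; a complete algebra norm is
-- passed explicitly to the Banach algebra results behind them.
open scoped Matrix.Norms.Operator in
theorem completeSpace_mat : @CompleteSpace (Mat A)
    (Matrix.linftyOpNormedRing (n := Fin 2) (α := A)).toMetricSpace.toUniformSpace :=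
  inferInstanceAs (CompleteSpace (Fin 2 → Fin 2 → A))

theorem hasDerivAt_exp_conj_mat (X q : Mat A) :
    HasDerivAt (fun t : ℝ => exp (t • X) * q * exp (-(t • X))) (X * q - q * X) 0 :=
  @hasDerivAt_exp_conj (Mat A) Matrix.linftyOpNormedRing Matrix.linftyOpNormedAlgebra
    completeSpace_mat X q

theorem hasSum_exp_mat (X : Mat A) :
    HasSum (fun n : ℕ => ((n.factorial : ℝ)⁻¹) • X ^ n) (exp X) :=
  @exp_series_hasSum_exp' ℝ (Mat A) _ _ _ Matrix.linftyOpNormedRing Matrix.linftyOpNormedAlgebra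
    completeSpace_mat X

/-- The exponential of a matrix, as a unit. -/
noncomputable def expUnit (X : Mat A) : (Mat A)ˣ where
  val := exp X
  inv := exp (-X)
  val_inv := exp_mul_exp_neg_mat X
  inv_val := by simpa using exp_mul_exp_neg_mat (-X)

theorem isThetaUnitary_expUnit {X : Mat A} (h : thetaAdj X = -X) :
    IsThetaUnitary (expUnit X) := by
  rw [isThetaUnitary_iff]
  change thetaAdj (exp X) * exp X = 1
  rw [thetaAdj_exp, h]
  exact (expUnit X).inv_val

theorem IsThetaUnitary.mul {g h : (Mat A)ˣ} (hg : IsThetaUnitary g) (hh : IsThetaUnitary h) :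
    IsThetaUnitary (g * h) := fun x y => by
  rw [Units.val_mul, ← Matrix.mulVec_mulVec, ← Matrix.mulVec_mulVec, hg, hh]

theorem IsThetaUnitary.inv {g : (Mat A)ˣ} (hg : IsThetaUnitary g) :
    IsThetaUnitary g⁻¹ := fun x y => by
  rw [← hg, Matrix.mulVec_mulVec, Matrix.mulVec_mulVec, Units.mul_inv, Matrix.one_mulVec,
    Matrix.one_mulVec]

theorem IsThetaUnitary.mul_thetaAdj {g : (Mat A)ˣ} (hg : IsThetaUnitary g) :
    (g : Mat A) * thetaAdj (g : Mat A) = 1 := by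
  have h := (isThetaUnitary_iff g).1 hg
  rw [(Units.inv_eq_of_mul_eq_one_left h).symm, Units.mul_inv]

/-! ### Lines, their coordinates and their projections. -/

theorem theta_smul_right (x y : Vec A) (a : A) :
    theta x (MulOpposite.op a • y) = theta x y * a := by
  simp [theta, sub_mul, mul_assoc]

theorem theta_smul_left (x y : Vec A) (a : A) :
    theta (MulOpposite.op a • x) y = star a * theta x y := by
  simp [theta, mul_sub, mul_assoc]

theorem mulVec_op_smul (g : Mat A) (y : Vec A) (a : A) :
    g.mulVec (MulOpposite.op a • y) = MulOpposite.op a • g.mulVec y :=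
  Matrix.mulVec_smul g _ y

theorem mem_line_iff {z : A} {y : Vec A} : y ∈ line z ↔ y 1 = z * y 0 := by
  rw [line, Submodule.mem_span_singleton]
  constructor
  · rintro ⟨a, rfl⟩
    simp
  · intro h
    refine ⟨MulOpposite.op (y 0), ?_⟩
    ext i; fin_cases i <;> simp [h]

theorem eq_smul_of_mem_line {z : A} {y : Vec A} (h : y ∈ line z) :
    y = MulOpposite.op (y 0) • ![1, z] := by
  rw [mem_line_iff] at h
  ext i; fin_cases i <;> simp [h]

theorem smul_mem_line (z a : A) : MulOpposite.op a • ![1, z] ∈ line z :=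
  Submodule.smul_mem _ _ (Submodule.subset_span rfl)

theorem theta_basePt (z : A) : theta ![1, z] ![1, z] = 1 - star z * z := by
  simp [theta]

/-- A line determines its point of the disk; identities for the action are read off from identities
between vectors in this way. -/
theorem eq_of_smul_basePt_mem_line {z w c : A} (hc : IsUnit c)
    (h : MulOpposite.op c • ![1, z] ∈ line w) : z = w := by
  rw [mem_line_iff] at h
  simp at h
  exact hc.mul_left_injective h

theorem act_one (z : A) : act (1 : Mat A) z = z := by simp [act]

theorem proj_mulVec (z : A) (y : Vec A) :
    (proj z).mulVec y =
      MulOpposite.op (Ring.inverse (1 - star z * z) * theta ![1, z] y) • ![1, z] := by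
  ext i; fin_cases i <;>
  · simp [proj, theta, Matrix.mulVec, dotProduct, Fin.sum_univ_two]
    noncomm_ring

/-! ### The action of `U(θ)` on the disk. -/

section Action

variable [PartialOrder A] [StarOrderedRing A]

/-- In a nontrivial algebra the norm of a nonnegative element lies in its spectrum, so `1 - ‖a‖`
lies in the positive spectrum of `1 - a`. -/
theorem norm_lt_one_iff_isStrictlyPositive {a : A} (ha : 0 ≤ a) :
    ‖a‖ < 1 ↔ IsStrictlyPositive (1 - a) := by
  rcases subsingleton_or_nontrivial A with h | h
  · simp [Subsingleton.elim a 0, IsStrictlyPositive.of_subsingleton]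
  constructor
  · intro h1
    refine ⟨?_, isUnit_one_sub_of_norm_lt_one h1⟩
    rw [sub_nonneg]
    exact (CStarAlgebra.norm_le_one_iff_of_nonneg a ha).1 h1.le
  · intro h1
    have h2 : (‖a‖ : ℝ) ∈ spectrum ℝ a := CStarAlgebra.norm_mem_spectrum_of_nonneg ha
    have h3 : 1 - ‖a‖ ∈ spectrum ℝ (1 - a) := by
      rw [← map_one (algebraMap ℝ A), ← spectrum.singleton_sub_eq]
      exact Set.sub_mem_sub rfl h2
    linarith [h1.spectrum_pos h3]

theorem mem_disk_iff {z : A} : z ∈ disk A ↔ IsStrictlyPositive (1 - star z * z) := by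
  rw [← norm_lt_one_iff_isStrictlyPositive (star_mul_self_nonneg z),
    CStarRing.norm_star_mul_self, disk, Set.mem_ofPred_eq]
  constructor
  · intro h; nlinarith [norm_nonneg z]
  · intro h; nlinarith [norm_nonneg z]

/-- The first coordinate of `g (1, z)`. -/
def denom (g : Mat A) (z : A) : A := g 0 0 + g 0 1 * z

/-- With first row `(a, b)`, the denominator is `a + bz = a(1 + a⁻¹bz)`, and `‖a⁻¹b‖ ≤ 1` while `‖z‖
< 1`. Both `aa* = 1 + bb*` and `a*a = 1 + c*c` are needed to invert `a`, since each alone gives only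
a one-sided inverse. -/
theorem isUnit_denom {g : (Mat A)ˣ} (hg : IsThetaUnitary g) {z : A} (hz : z ∈ disk A) :
    IsUnit (denom (g : Mat A) z) := by
  have hgs := hg.mul_thetaAdj
  have h1 := congrFun (congrFun hgs 0) 0
  simp only [thetaAdj, Matrix.mul_apply, Fin.sum_univ_two, Matrix.of_apply, Matrix.cons_val',
    Matrix.cons_val_zero, Matrix.cons_val_one, Matrix.cons_val_fin_one, Matrix.one_apply_eq] at h1
  have h2 := congrFun (congrFun ((isThetaUnitary_iff g).1 hg) 0) 0
  simp only [thetaAdj, Matrix.mul_apply, Fin.sum_univ_two, Matrix.of_apply, Matrix.cons_val',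
    Matrix.cons_val_zero, Matrix.cons_val_one, Matrix.cons_val_fin_one, Matrix.one_apply_eq] at h2
  set a := (g : Mat A) 0 0
  set b := (g : Mat A) 0 1
  set c := (g : Mat A) 1 0
  have e1 : a * star a = 1 + b * star b := by rw [← h1]; noncomm_ring
  have e2 : star a * a = 1 + star c * c := by rw [← h2]; noncomm_ring
  have u1 : IsUnit (a * star a) := CStarAlgebra.isUnit_of_le 1 (by
    rw [e1]; exact le_add_of_nonneg_right (mul_star_self_nonneg b))
  have u2 : IsUnit (star a * a) := CStarAlgebra.isUnit_of_le 1 (by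
    rw [e2]; exact le_add_of_nonneg_right (star_mul_self_nonneg c))
  have ua : IsUnit a := by
    rw [isUnit_iff_exists]
    obtain ⟨v1, hv1⟩ := u1.exists_right_inv
    obtain ⟨v2, hv2⟩ := u2.exists_left_inv
    have e : star a * v1 = v2 * star a := by
      calc star a * v1 = v2 * (star a * a) * (star a * v1) := by rw [hv2, one_mul]
        _ = v2 * star a * (a * star a * v1) := by noncomm_ring
        _ = v2 * star a := by rw [hv1, mul_one]
    exact ⟨star a * v1, by rw [← mul_assoc, hv1], by rw [e, mul_assoc, hv2]⟩
  obtain ⟨u, hu⟩ := ua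
  -- Conjugating `bb* = aa* - 1` by `a⁻¹` gives `(a⁻¹b)(a⁻¹b)* = 1 - a⁻¹(a⁻¹)* ≤ 1`.
  have hb : ‖((u⁻¹ : Aˣ) : A) * b‖ ≤ 1 := by
    have e3 : ((u⁻¹ : Aˣ) : A) * b * star (((u⁻¹ : Aˣ) : A) * b) =
        1 - ((u⁻¹ : Aˣ) : A) * star ((u⁻¹ : Aˣ) : A) := by
      have e4 : b * star b = a * star a - 1 := by rw [e1]; abel
      calc _ = ((u⁻¹ : Aˣ) : A) * (b * star b) * star ((u⁻¹ : Aˣ) : A) := by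
              rw [star_mul]; noncomm_ring
        _ = (((u⁻¹ : Aˣ) : A) * u) * star (((u⁻¹ : Aˣ) : A) * u)
            - ((u⁻¹ : Aˣ) : A) * star ((u⁻¹ : Aˣ) : A) := by
              rw [e4, ← hu, star_mul]; noncomm_ring
        _ = _ := by simp
    have h3 : ‖((u⁻¹ : Aˣ) : A) * b * star (((u⁻¹ : Aˣ) : A) * b)‖ ≤ 1 := by
      rw [CStarAlgebra.norm_le_one_iff_of_nonneg _ (mul_star_self_nonneg _), e3]
      exact sub_le_self _ (mul_star_self_nonneg _)
    rw [CStarRing.norm_self_mul_star] at h3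
    nlinarith [norm_nonneg (((u⁻¹ : Aˣ) : A) * b)]
  have hz' : ‖z‖ < 1 := hz
  have h4 : ‖-(((u⁻¹ : Aˣ) : A) * b * z)‖ < 1 := by
    rw [norm_neg]
    refine (norm_mul_le _ _).trans_lt ?_
    nlinarith [norm_nonneg z]
  have h5 := isUnit_one_sub_of_norm_lt_one h4
  have h6 : denom (g : Mat A) z = u * (1 - -(((u⁻¹ : Aˣ) : A) * b * z)) := by
    rw [sub_neg_eq_add, mul_add, mul_one, ← mul_assoc, ← mul_assoc, Units.mul_inv, one_mul, hu]
    rfl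
  rw [h6]
  exact u.isUnit.mul h5

theorem mulVec_basePt {g : (Mat A)ˣ} (hg : IsThetaUnitary g) {z : A} (hz : z ∈ disk A) :
    (g : Mat A).mulVec ![1, z] =
      MulOpposite.op (denom (g : Mat A) z) • ![1, act (g : Mat A) z] := by
  have h := isUnit_denom hg hz
  ext i; fin_cases i
  · simp [Matrix.mulVec, dotProduct, Fin.sum_univ_two, denom]
  · simp only [Matrix.mulVec, dotProduct, Fin.sum_univ_two, act, Fin.mk_one, Matrix.cons_val_zero,
      Matrix.cons_val_one, Matrix.cons_val_fin_one, mul_one, Pi.smul_apply,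
      MulOpposite.smul_eq_mul_unop, MulOpposite.unop_op]
    rw [mul_assoc]
    change _ = _ * (Ring.inverse (denom _ _) * denom _ _)
    rw [Ring.inverse_mul_cancel _ h, mul_one]

theorem mulVec_mem_line {g : (Mat A)ˣ} (hg : IsThetaUnitary g) {z : A} (hz : z ∈ disk A)
    {y : Vec A} (hy : y ∈ line z) : (g : Mat A).mulVec y ∈ line (act (g : Mat A) z) := by
  rw [eq_smul_of_mem_line hy, mulVec_op_smul, mulVec_basePt hg hz, smul_smul]
  exact smul_mem_line _ _

/-- With `w = g · z` and denominator `c`, invariance of `θ` on `(1, z)` reads `c*(1 - w*w)c = 1 -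
z*z`, and conjugation by the invertible `c` preserves strict positivity. -/
theorem act_mem_disk {g : (Mat A)ˣ} (hg : IsThetaUnitary g) {z : A} (hz : z ∈ disk A) :
    act (g : Mat A) z ∈ disk A := by
  have h := hg ![1, z] ![1, z]
  rw [mulVec_basePt hg hz, theta_smul_left, theta_smul_right, theta_basePt, theta_basePt,
    ← mul_assoc] at h
  have hu := isUnit_denom hg hz
  rw [mem_disk_iff] at hz ⊢
  rwa [← h, hu.isStrictlyPositive_star_left_conjugate_iff] at hz

theorem act_mul {g h : (Mat A)ˣ} (hg : IsThetaUnitary g) (hh : IsThetaUnitary h) {z : A}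
    (hz : z ∈ disk A) :
    act ((g * h : (Mat A)ˣ) : Mat A) z = act (g : Mat A) (act (h : Mat A) z) := by
  have h1 := mulVec_mem_line hg (act_mem_disk hh hz)
    (mulVec_mem_line hh hz (y := ![1, z]) (by simp [mem_line_iff]))
  rw [Matrix.mulVec_mulVec, ← Units.val_mul, mulVec_basePt (hg.mul hh) hz] at h1
  exact eq_of_smul_basePt_mem_line (isUnit_denom (hg.mul hh) hz) h1

theorem act_inv_act {g : (Mat A)ˣ} (hg : IsThetaUnitary g) {z : A} (hz : z ∈ disk A) :
    act ((g⁻¹ : (Mat A)ˣ) : Mat A) (act (g : Mat A) z) = z := by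
  rw [← act_mul hg.inv hg hz, inv_mul_cancel, Units.val_one, act_one]

theorem act_act_inv {g : (Mat A)ˣ} (hg : IsThetaUnitary g) {z : A} (hz : z ∈ disk A) :
    act (g : Mat A) (act ((g⁻¹ : (Mat A)ˣ) : Mat A) z) = z := by
  rw [← act_mul hg hg.inv hz, mul_inv_cancel, Units.val_one, act_one]

theorem proj_act_mul {g : (Mat A)ˣ} (hg : IsThetaUnitary g) {z : A} (hz : z ∈ disk A) :
    proj (act (g : Mat A) z) * g = g * proj z := by
  refine mat_ext_mulVec fun y => ?_
  have h := hg ![1, z] ![1, z]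
  rw [mulVec_basePt hg hz, theta_smul_left, theta_smul_right, theta_basePt, theta_basePt] at h
  have hy := hg ![1, z] y
  rw [mulVec_basePt hg hz, theta_smul_left] at hy
  rw [← Matrix.mulVec_mulVec, ← Matrix.mulVec_mulVec, proj_mulVec, proj_mulVec, mulVec_op_smul,
    mulVec_basePt hg hz, smul_smul, ← MulOpposite.op_mul, ← hy, ← h]
  congr 2
  obtain ⟨c, hc⟩ := isUnit_denom hg hz
  obtain ⟨d, hd⟩ := (mem_disk_iff.1 (act_mem_disk hg hz)).isUnit
  rw [← hc, ← hd, ← Units.coe_star, ← Units.val_mul, ← Units.val_mul, Ring.inverse_unit,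
    Ring.inverse_unit, mul_inv_rev, mul_inv_rev]
  simp only [Units.val_mul, mul_assoc, Units.inv_mul_cancel_left, Units.mul_inv_cancel_left]

theorem proj_act {g : (Mat A)ˣ} (hg : IsThetaUnitary g) {z : A} (hz : z ∈ disk A) :
    proj (act (g : Mat A) z) = g * proj z * ((g⁻¹ : (Mat A)ˣ) : Mat A) := by
  rw [← proj_act_mul hg hz, Units.mul_inv_cancel_right]

end Action

/-! ### Equivariance of geodesics, and their velocities. -/

theorem IsHorizontal.thetaAdj_eq {z : A} {X : Mat A} (h : IsHorizontal z X) :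
    thetaAdj X = -X := (theta_antisymm_iff X).1 h.1

theorem thetaAdj_smul {X : Mat A} (h : thetaAdj X = -X) (t : ℝ) :
    thetaAdj (t • X) = -(t • X) := by
  rw [← smul_neg, ← h]
  ext i j; fin_cases i <;> fin_cases j <;> simp [thetaAdj]

theorem expUnit_val (X : Mat A) : ((expUnit X : (Mat A)ˣ) : Mat A) = exp X := rfl

theorem expUnit_conj (g : (Mat A)ˣ) (X : Mat A) :
    expUnit ((g : Mat A) * X * ((g⁻¹ : (Mat A)ˣ) : Mat A)) = g * expUnit X * g⁻¹ := by
  ext1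
  simp only [Units.val_mul, expUnit_val, matrix_exp_units_conj]

theorem smul_conj (g : (Mat A)ˣ) (X : Mat A) (t : ℝ) :
    t • ((g : Mat A) * X * ((g⁻¹ : (Mat A)ˣ) : Mat A)) =
      (g : Mat A) * (t • X) * ((g⁻¹ : (Mat A)ˣ) : Mat A) := by
  rw [Matrix.mul_smul, Matrix.smul_mul]

section Equivariance

variable [PartialOrder A] [StarOrderedRing A]

theorem IsHorizontal.conj {g : (Mat A)ˣ} (hg : IsThetaUnitary g) {z : A} (hz : z ∈ disk A)
    {X : Mat A} (h : IsHorizontal z X) :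
    IsHorizontal (act (g : Mat A) z) ((g : Mat A) * X * ((g⁻¹ : (Mat A)ˣ) : Mat A)) := by
  have e1 : 1 - proj (act (g : Mat A) z) =
      g * (1 - proj z) * ((g⁻¹ : (Mat A)ˣ) : Mat A) := by
    rw [proj_act hg hz, mul_sub, sub_mul, mul_one, Units.mul_inv]
  have e2 (p : Mat A) : (g : Mat A) * p * ((g⁻¹ : (Mat A)ˣ) : Mat A) *
      ((g : Mat A) * X * ((g⁻¹ : (Mat A)ˣ) : Mat A)) *
      ((g : Mat A) * p * ((g⁻¹ : (Mat A)ˣ) : Mat A)) =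
      (g : Mat A) * (p * X * p) * ((g⁻¹ : (Mat A)ˣ) : Mat A) := by
    simp only [mul_assoc, Units.inv_mul_cancel_left]
  refine ⟨fun x y => ?_, ?_, ?_⟩
  · have h1 := h.1 (((g⁻¹ : (Mat A)ˣ) : Mat A).mulVec x) (((g⁻¹ : (Mat A)ˣ) : Mat A).mulVec y)
    rw [← hg, ← hg (((g⁻¹ : (Mat A)ˣ) : Mat A).mulVec x)] at h1
    simpa only [Matrix.mulVec_mulVec, Units.mul_inv, Matrix.one_mulVec, mul_assoc] using h1
  · rw [proj_act hg hz, e2, h.2.1, mul_zero, zero_mul]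
  · rw [e1, e2, h.2.2, mul_zero, zero_mul]

theorem geodesic_conj {g : (Mat A)ˣ} (hg : IsThetaUnitary g) {z : A} (hz : z ∈ disk A)
    {X : Mat A} (h : thetaAdj X = -X) (t : ℝ) :
    geodesic (act (g : Mat A) z) ((g : Mat A) * X * ((g⁻¹ : (Mat A)ˣ) : Mat A)) t =
      act (g : Mat A) (geodesic z X t) := by
  have hu := isThetaUnitary_expUnit (thetaAdj_smul h t)
  rw [geodesic, geodesic, smul_conj, ← expUnit_val, ← expUnit_val, expUnit_conj,
    ← act_mul ((hg.mul hu).mul hg.inv) hg hz, inv_mul_cancel_right, act_mul hg hu hz]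

theorem Joins.conj {g : (Mat A)ˣ} (hg : IsThetaUnitary g) {z w : A} (hz : z ∈ disk A)
    {X : Mat A} (h : Joins z w X) :
    Joins (act (g : Mat A) z) (act (g : Mat A) w)
      ((g : Mat A) * X * ((g⁻¹ : (Mat A)ˣ) : Mat A)) :=
  ⟨h.1.conj hg hz, by rw [geodesic_conj hg hz h.1.thetaAdj_eq, h.2]⟩

theorem proj_geodesic {z : A} (hz : z ∈ disk A) {X : Mat A} (h : thetaAdj X = -X) (t : ℝ) :
    proj (geodesic z X t) = exp (t • X) * proj z * exp (-(t • X)) :=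
  proj_act (isThetaUnitary_expUnit (thetaAdj_smul h t)) hz

theorem hasDerivAt_proj_geodesic {z : A} (hz : z ∈ disk A) {X : Mat A} (h : thetaAdj X = -X) :
    HasDerivAt (fun t : ℝ => proj (geodesic z X t)) (X * proj z - proj z * X) 0 := by
  simp_rw [proj_geodesic hz h]
  exact hasDerivAt_exp_conj_mat X _

theorem hasDerivAt_refl_geodesic {z : A} (hz : z ∈ disk A) {X : Mat A} (h : thetaAdj X = -X) :
    HasDerivAt (fun t : ℝ => refl (geodesic z X t)) (2 • (X * proj z - proj z * X)) 0 := by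
  have h1 (t : ℝ) : refl (geodesic z X t) = exp (t • X) * refl z * exp (-(t • X)) := by
    rw [refl, refl, proj_geodesic hz h, mul_sub, sub_mul, mul_one, exp_mul_exp_neg_mat]
    noncomm_ring
  simp_rw [h1]
  convert hasDerivAt_exp_conj_mat X (refl z) using 1
  rw [refl]
  noncomm_ring

theorem proj_mulVec_of_mem_line {z : A} (hz : z ∈ disk A) {y : Vec A} (hy : y ∈ line z) :
    (proj z).mulVec y = y := by
  rw [eq_smul_of_mem_line hy, mulVec_op_smul, proj_mulVec, theta_basePt,
    Ring.inverse_mul_cancel _ (mem_disk_iff.1 hz).isUnit]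
  simp

/-- Co-diagonality kills `q_z X` on `ℓ_z`, so the modulus of the velocity can be computed from `X`
itself. -/
theorem velocity_mulVec {z : A} (hz : z ∈ disk A) {X : Mat A} (h : IsHorizontal z X)
    {y : Vec A} (hy : y ∈ line z) : (X * proj z - proj z * X).mulVec y = X.mulVec y := by
  have h1 : (proj z * X).mulVec y = 0 := by
    rw [← proj_mulVec_of_mem_line hz hy, Matrix.mulVec_mulVec, h.2.1, Matrix.zero_mulVec]
  rw [Matrix.sub_mulVec, h1, sub_zero, ← Matrix.mulVec_mulVec, proj_mulVec_of_mem_line hz hy]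

end Equivariance

/-! ### Hyperbolic functions of a square root, as power series. -/

/-- The value at `a` of the entire function `s ↦ cosh √s`. -/
noncomputable def coshSqrt (a : A) : A := ∑' k : ℕ, ((2 * k).factorial : ℝ)⁻¹ • a ^ k

/-- The value at `a` of the entire function `s ↦ sinh √s / √s`. -/
noncomputable def sinhcSqrt (a : A) : A := ∑' k : ℕ, ((2 * k + 1).factorial : ℝ)⁻¹ • a ^ k

theorem summable_of_factorial_le {f : ℕ → ℕ} (hf : ∀ k, k.factorial ≤ f k) (a : A) :
    Summable fun k : ℕ => ((f k : ℝ))⁻¹ • a ^ k := by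
  refine Summable.of_norm_bounded (norm_expSeries_summable' (𝕂 := ℝ) a) fun k => ?_
  rw [norm_smul, norm_smul]
  have h1 : (0 : ℝ) < k.factorial := by positivity
  have h2 : (k.factorial : ℝ) ≤ f k := by exact_mod_cast hf k
  simp only [norm_inv, RCLike.norm_natCast]
  gcongr

theorem hasSum_coshSqrt (a : A) :
    HasSum (fun k : ℕ => ((2 * k).factorial : ℝ)⁻¹ • a ^ k) (coshSqrt a) :=
  (summable_of_factorial_le (fun _ => Nat.factorial_le (by omega)) a).hasSum

theorem hasSum_sinhcSqrt (a : A) :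
    HasSum (fun k : ℕ => ((2 * k + 1).factorial : ℝ)⁻¹ • a ^ k) (sinhcSqrt a) :=
  (summable_of_factorial_le (fun _ => Nat.factorial_le (by omega)) a).hasSum

theorem exp_eq_coshSqrt_add (p : A) :
    exp p = coshSqrt (p * p) + p * sinhcSqrt (p * p) := by
  have e (k : ℕ) : (p * p) ^ k = p ^ (2 * k) := by rw [pow_mul, pow_two]
  have h0 := hasSum_coshSqrt (p * p)
  have h1 := (hasSum_sinhcSqrt (p * p)).mul_left p
  simp only [e, mul_smul_comm, ← pow_succ'] at h0 h1
  exact (exp_series_hasSum_exp' (𝕂 := ℝ) p).unique (HasSum.even_add_odd h0 h1)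

theorem exp_neg_eq_coshSqrt_sub (p : A) :
    exp (-p) = coshSqrt (p * p) - p * sinhcSqrt (p * p) := by
  rw [exp_eq_coshSqrt_add, neg_mul_neg, neg_mul, sub_eq_add_neg]

theorem commute_tsum {f : ℕ → A} {a b : A} (h : HasSum f b) (hf : ∀ k, Commute a (f k)) :
    Commute a b := by
  have h1 := h.mul_left a
  simp_rw [(hf _).eq] at h1
  exact h1.unique (h.mul_right a)

theorem commute_coshSqrt {a b : A} (h : Commute a b) : Commute a (coshSqrt b) :=
  commute_tsum (hasSum_coshSqrt b) fun k => (h.pow_right k).smul_right _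

theorem commute_sinhcSqrt {a b : A} (h : Commute a b) : Commute a (sinhcSqrt b) :=
  commute_tsum (hasSum_sinhcSqrt b) fun k => (h.pow_right k).smul_right _

theorem commute_sinhcSqrt_coshSqrt (a : A) : Commute (sinhcSqrt a) (coshSqrt a) :=
  commute_coshSqrt (commute_sinhcSqrt (Commute.refl a)).symm

section Order

variable [PartialOrder A] [StarOrderedRing A]

/-- All terms are nonnegative and the term of index `0` is `1`. -/
theorem one_le_of_hasSum_smul_pow {c : ℕ → ℝ} (h0 : c 0 = 1) (hc : ∀ k, 0 ≤ c k) {a b : A}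
    (ha : 0 ≤ a) (h : HasSum (fun k => c k • a ^ k) b) : 1 ≤ b := by
  have h1 : c 0 • a ^ 0 ≤ b :=
    le_hasSum h 0 fun k _ => smul_nonneg (hc k) (CStarAlgebra.pow_nonneg ha k)
  simpa [h0] using h1

theorem one_le_coshSqrt {a : A} (ha : 0 ≤ a) : 1 ≤ coshSqrt a :=
  one_le_of_hasSum_smul_pow (by simp) (fun _ => by positivity) ha (hasSum_coshSqrt a)

theorem one_le_sinhcSqrt {a : A} (ha : 0 ≤ a) : 1 ≤ sinhcSqrt a :=
  one_le_of_hasSum_smul_pow (by simp) (fun _ => by positivity) ha (hasSum_sinhcSqrt a)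

theorem isStrictlyPositive_coshSqrt {a : A} (ha : 0 ≤ a) : IsStrictlyPositive (coshSqrt a) :=
  isStrictlyPositive_one.of_le (one_le_coshSqrt ha)

theorem isStrictlyPositive_sinhcSqrt {a : A} (ha : 0 ≤ a) : IsStrictlyPositive (sinhcSqrt a) :=
  isStrictlyPositive_one.of_le (one_le_sinhcSqrt ha)

end Order

/-! ### Horizontal matrices at `0` and their exponentials. -/

/-- The `θ`-antisymmetric matrix with rows `(0, α*)` and `(α, 0)`. -/
def codiag (α : A) : Mat A := !![0, star α; α, 0]

theorem thetaAdj_codiag (α : A) : thetaAdj (codiag α) = -codiag α := by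
  ext i j; fin_cases i <;> fin_cases j <;> simp [thetaAdj, codiag]

theorem proj_zero : proj (0 : A) = !![1, 0; 0, 0] := by
  simp [proj]

theorem isHorizontal_zero_iff {X : Mat A} : IsHorizontal 0 X ↔ ∃ α, X = codiag α := by
  have e : (1 : Mat A) - !![1, 0; 0, 0] = !![0, 0; 0, 1] := by
    ext i j; fin_cases i <;> fin_cases j <;> simp
  rw [IsHorizontal, theta_antisymm_iff, proj_zero, e]
  constructor
  · rintro ⟨h1, h2, h3⟩
    refine ⟨X 1 0, ?_⟩
    have a1 := congrFun (congrFun h2 0) 0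
    have a2 := congrFun (congrFun h3 1) 1
    have a3 := congrFun (congrFun h1 0) 1
    simp [Matrix.mul_apply, Fin.sum_univ_two, Matrix.vecMul, dotProduct] at a1 a2
    simp [thetaAdj] at a3
    ext i j; fin_cases i <;> fin_cases j <;> simp [codiag, a1, a2, a3]
  · rintro ⟨α, rfl⟩
    refine ⟨thetaAdj_codiag α, ?_, ?_⟩ <;>
    · ext i j
      fin_cases i <;> fin_cases j <;> simp [codiag, Matrix.mul_apply, Fin.sum_univ_two]

theorem codiag_pow_even (α : A) (k : ℕ) :
    codiag α ^ (2 * k) = !![(star α * α) ^ k, 0; 0, (α * star α) ^ k] := by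
  have h : codiag α ^ 2 = Matrix.diagonal ![star α * α, α * star α] := by
    ext i j; fin_cases i <;> fin_cases j <;>
      simp [codiag, pow_two, Matrix.mul_apply, Fin.sum_univ_two]
  rw [pow_mul, h, Matrix.diagonal_pow]
  ext i j; fin_cases i <;> fin_cases j <;> simp

theorem codiag_pow_odd (α : A) (k : ℕ) :
    codiag α ^ (2 * k + 1) =
      !![0, star α * (α * star α) ^ k; α * (star α * α) ^ k, 0] := by
  rw [pow_succ', codiag_pow_even, codiag]
  ext i j; fin_cases i <;> fin_cases j <;> simp [Matrix.mul_apply, Fin.sum_univ_two]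

/-- Even powers of `codiag α` are diagonal and odd powers are co-diagonal, so each entry of the
first column receives only one half of the series. -/
theorem exp_codiag_mulVec (α : A) :
    (exp (codiag α)).mulVec ![1, 0] =
      ![coshSqrt (star α * α), α * sinhcSqrt (star α * α)] := by
  have h := hasSum_exp_mat (codiag α)
  have h1 (i j) : HasSum (fun n : ℕ => (((n.factorial : ℝ)⁻¹) • codiag α ^ n) i j)
      (exp (codiag α) i j) := Pi.hasSum.1 (Pi.hasSum.1 h i) j
  have h00 := (h1 0 0).unique <| HasSum.even_add_odd (m' := 0)
    (by simpa [codiag_pow_even] using hasSum_coshSqrt (star α * α))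
    (by simp [codiag_pow_odd])
  have h10 := (h1 1 0).unique <| HasSum.even_add_odd (m := 0)
    (by simp [codiag_pow_even])
    (by simpa [codiag_pow_odd] using (hasSum_sinhcSqrt (star α * α)).mul_left α)
  ext i; fin_cases i <;> simp [Matrix.mulVec, dotProduct, Fin.sum_univ_two, h00, h10]

theorem geodesic_codiag (α : A) :
    geodesic 0 (codiag α) 1 =
      α * sinhcSqrt (star α * α) * Ring.inverse (coshSqrt (star α * α)) := by
  have h := exp_codiag_mulVec α
  have h0 := congrFun h 0
  have h1 := congrFun h 1
  simp [Matrix.mulVec, dotProduct, Fin.sum_univ_two] at h0 h1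
  simp [geodesic, act, h0, h1]

theorem commute_ringInverse {a b : A} (h : Commute a b) : Commute a (Ring.inverse b) := by
  by_cases hb : IsUnit b
  · obtain ⟨u, rfl⟩ := hb
    rw [Ring.inverse_unit]
    exact h.units_inv_right
  · rw [Ring.inverse_non_unit _ hb]
    exact Commute.zero_right a

theorem exp_mul_exp_neg_self (p : A) : exp p * exp (-p) = 1 := by
  let _ : NormedAlgebra ℚ A := NormedAlgebra.restrictScalars ℚ ℝ A
  rw [← exp_add_of_commute (Commute.refl p).neg_right, add_neg_cancel, exp_zero]

theorem exp_neg_mul_exp_self (p : A) : exp (-p) * exp p = 1 := by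
  simpa using exp_mul_exp_neg_self (-p)

theorem exp_mul_exp_self (p : A) : exp p * exp p = exp ((2 : ℝ) • p) := by
  let _ : NormedAlgebra ℚ A := NormedAlgebra.restrictScalars ℚ ℝ A
  rw [← exp_add_of_commute (Commute.refl p), two_smul]

/-- The function `s ↦ tanh √s / √s`. -/
noncomputable def tanhcSqrt (a : A) : A := sinhcSqrt a * Ring.inverse (coshSqrt a)

theorem commute_tanhcSqrt {a b : A} (h : Commute a b) : Commute a (tanhcSqrt b) :=
  (commute_sinhcSqrt h).mul_right (commute_ringInverse (commute_coshSqrt h))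

theorem zero_mem_disk : (0 : A) ∈ disk A := by simp [disk]

/-! ### Existence and uniqueness of geodesics. -/

section Geodesics

variable [PartialOrder A] [StarOrderedRing A]

theorem isStrictlyPositive_tanhcSqrt {a : A} (ha : 0 ≤ a) :
    IsStrictlyPositive (tanhcSqrt a) := by
  have hS := isStrictlyPositive_sinhcSqrt ha
  have hC := (isStrictlyPositive_coshSqrt ha).ringInverse
  exact ⟨(commute_ringInverse (commute_sinhcSqrt_coshSqrt a)).mul_nonneg hS.nonneg hC.nonneg,
    hS.isUnit.mul hC.isUnit⟩

/-- This is `|z| = tanh |α|`: the endpoint is `αT` with `T` positive and commuting with `|α|`, so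
`|α|T` is the positive square root of `(αT)*(αT)`. -/
theorem abs_geodesic_codiag (α : A) :
    CFC.abs (geodesic 0 (codiag α) 1) = CFC.abs α * tanhcSqrt (star α * α) := by
  set T := tanhcSqrt (star α * α) with hT
  have hp := CFC.abs_mul_abs α
  have hT0 := isStrictlyPositive_tanhcSqrt (star_mul_self_nonneg α)
  have hc : Commute (CFC.abs α) T := by
    refine commute_tanhcSqrt ?_
    rw [← hp]
    exact (Commute.refl _).mul_right (Commute.refl _)
  have hz : geodesic 0 (codiag α) 1 = α * T := by
    rw [geodesic_codiag, mul_assoc]; rfl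
  refine CFC.sqrt_unique ?_ (hc.mul_nonneg (CFC.abs_nonneg α) hT0.nonneg)
  rw [hz, star_mul, hT0.isSelfAdjoint.star_eq]
  calc CFC.abs α * T * (CFC.abs α * T) = T * CFC.abs α * (CFC.abs α * T) := by rw [hc.eq]
    _ = T * (CFC.abs α * CFC.abs α) * T := by noncomm_ring
    _ = _ := by rw [hp]; noncomm_ring

/-- With `r = tanh p`, multiplying `1 ± r` by `cosh p` gives `e^{±p}`. Only `p²` has to be
nonnegative, which makes `cosh p` invertible. -/
theorem add_mul_ringInverse_sub_eq_exp {p : A} (hp : 0 ≤ p * p) {r : A}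
    (hr : r = p * tanhcSqrt (p * p)) :
    (1 + r) * Ring.inverse (1 - r) = exp ((2 : ℝ) • p) := by
  have hC := (isStrictlyPositive_coshSqrt hp).isUnit
  have hrC : r * coshSqrt (p * p) = p * sinhcSqrt (p * p) := by
    rw [hr, tanhcSqrt, mul_assoc, mul_assoc, Ring.inverse_mul_cancel _ hC, mul_one]
  have h1 : (1 + r) * coshSqrt (p * p) = exp p := by
    rw [add_mul, one_mul, hrC, exp_eq_coshSqrt_add]
  have h2 : (1 - r) * coshSqrt (p * p) = exp (-p) := by
    rw [sub_mul, one_mul, hrC, exp_neg_eq_coshSqrt_sub]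
  obtain ⟨c, hc⟩ := hC
  let e : Aˣ := ⟨exp p, exp (-p), exp_mul_exp_neg_self p, exp_neg_mul_exp_self p⟩
  have h3 : 1 - r = ((e⁻¹ * c⁻¹ : Aˣ) : A) := by
    rw [Units.val_mul, Units.eq_mul_inv_iff_mul_eq, hc, h2]; rfl
  have h4 : 1 + r = ((e * c⁻¹ : Aˣ) : A) := by
    rw [Units.val_mul, Units.eq_mul_inv_iff_mul_eq, hc, h1]
  rw [h3, h4, Ring.inverse_unit, ← Units.val_mul, ← exp_mul_exp_self]
  simp [e, mul_assoc]

theorem isStrictlyPositive_crossRatio {r : A} (h0 : 0 ≤ r) (h1 : ‖r‖ < 1) :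
    IsStrictlyPositive ((1 + r) * Ring.inverse (1 - r)) := by
  have h2 := ((norm_lt_one_iff_isStrictlyPositive h0).1 h1).ringInverse
  have h3 : IsStrictlyPositive (1 + r) := isStrictlyPositive_one.add_nonneg h0
  have h4 : Commute (1 + r) (1 - r) :=
    ((Commute.one_left _).add_left ((Commute.one_right r).sub_right (Commute.refl r)))
  exact ⟨(commute_ringInverse h4).mul_nonneg h3.nonneg h2.nonneg, h3.isUnit.mul h2.isUnit⟩

/-- The cross ratio of `0` and the endpoint of the geodesic with velocity `α`. -/
theorem crossRatio_geodesic_codiag (α : A) :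
    (1 + CFC.abs (geodesic 0 (codiag α) 1)) *
      Ring.inverse (1 - CFC.abs (geodesic 0 (codiag α) 1)) = exp ((2 : ℝ) • CFC.abs α) := by
  refine add_mul_ringInverse_sub_eq_exp ?_ ?_
  · rw [CFC.abs_mul_abs]; exact star_mul_self_nonneg α
  · rw [abs_geodesic_codiag, CFC.abs_mul_abs]

/-- The logarithm of the cross ratio recovers `|α|` from the endpoint; then the factor `tanh |α| /
|α|` is known and can be cancelled. -/
theorem codiag_unique {α β : A} (h : geodesic 0 (codiag α) 1 = geodesic 0 (codiag β) 1) :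
    α = β := by
  have h1 := crossRatio_geodesic_codiag α
  rw [h, crossRatio_geodesic_codiag β] at h1
  have h2 (γ : A) : IsSelfAdjoint ((2 : ℝ) • CFC.abs γ) :=
    (IsSelfAdjoint.all _).smul (IsSelfAdjoint.of_nonneg (CFC.abs_nonneg γ))
  have h3 := congrArg CFC.log h1
  rw [CFC.log_exp _ (h2 _), CFC.log_exp _ (h2 _)] at h3
  have h4 : CFC.abs β = CFC.abs α := smul_right_injective A two_ne_zero h3
  have h5 : star β * β = star α * α := by rw [← CFC.abs_mul_abs, ← CFC.abs_mul_abs, h4]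
  rw [geodesic_codiag, geodesic_codiag, mul_assoc, mul_assoc, h5] at h
  exact (isStrictlyPositive_tanhcSqrt (star_mul_self_nonneg α)).isUnit.mul_left_injective h

theorem exists_codiag {z : A} (hz : z ∈ disk A) : ∃ α, geodesic 0 (codiag α) 1 = z := by
  set r := CFC.abs z with hr
  have hr1 : ‖r‖ < 1 := by rw [hr, CFC.norm_abs]; exact hz
  have hr0 : 0 ≤ r := CFC.abs_nonneg z
  have hs := isStrictlyPositive_crossRatio hr0 hr1
  -- This is `p = artanh |z|`. Self-adjointness suffices below, because only `p² ≥ 0` is used.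
  set p := (1 / 2 : ℝ) • CFC.log ((1 + r) * Ring.inverse (1 - r)) with hp
  have hpsa : IsSelfAdjoint p := (IsSelfAdjoint.all _).smul IsSelfAdjoint.log
  have hpp : 0 ≤ p * p := hpsa.mul_self_nonneg
  have hexp : exp p * exp p = (1 + r) * Ring.inverse (1 - r) := by
    rw [exp_mul_exp_self, hp, smul_smul]
    norm_num
    exact CFC.exp_log _ hs
  have hu : IsUnit (1 - r) := ((norm_lt_one_iff_isStrictlyPositive hr0).1 hr1).isUnit
  have h1 : exp p * (1 - r) = exp (-p) * (1 + r) := by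
    calc exp p * (1 - r) = exp (-p) * (exp p * exp p) * (1 - r) := by
          rw [← mul_assoc, exp_neg_mul_exp_self, one_mul]
      _ = _ := by rw [hexp, mul_assoc, mul_assoc, Ring.inverse_mul_cancel _ hu, mul_one]
  have hC := (isStrictlyPositive_coshSqrt hpp).isUnit
  -- Expanding `e^{±p} = cosh p ± sinh p` in `h1` gives this identity up to a factor `2`.
  have h2 : coshSqrt (p * p) * r = p * sinhcSqrt (p * p) := by
    rw [exp_eq_coshSqrt_add, exp_neg_eq_coshSqrt_sub] at h1
    refine smul_right_injective A (two_ne_zero (α := ℝ)) ?_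
    simp only [two_smul]
    have := sub_eq_zero.2 h1
    rw [← sub_eq_zero, ← neg_eq_zero, ← this]
    noncomm_ring
  have hcp : Commute p (p * p) := (Commute.refl p).mul_right (Commute.refl p)
  have h3 : r = p * tanhcSqrt (p * p) := by
    rw [tanhcSqrt, (commute_ringInverse (commute_sinhcSqrt_coshSqrt (p * p))).eq, ← mul_assoc,
      (commute_ringInverse (commute_coshSqrt hcp)).eq, mul_assoc, ← h2, ← mul_assoc,
      Ring.inverse_mul_cancel _ hC, one_mul]
  have hT := isStrictlyPositive_tanhcSqrt hpp
  set T := tanhcSqrt (p * p) with hTdef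
  -- Since `z = αT` is required with `T = tanh p / p`, the candidate is `zT⁻¹`; it remains to see
  -- that `α*α = p²`, so that its own factor is again `T`.
  refine ⟨z * Ring.inverse T, ?_⟩
  have h4 : star (z * Ring.inverse T) * (z * Ring.inverse T) = p * p := by
    have h5 : star z * z = T * p * (p * T) := by
      rw [← CFC.abs_mul_abs, ← hr, h3, (commute_tanhcSqrt hcp).eq]
    rw [star_mul, ← Ring.inverse_star, hT.isSelfAdjoint.star_eq]
    calc Ring.inverse T * star z * (z * Ring.inverse T)
        = Ring.inverse T * (star z * z) * Ring.inverse T := by noncomm_ring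
      _ = (Ring.inverse T * T) * p * (p * (T * Ring.inverse T)) := by rw [h5]; noncomm_ring
      _ = p * p := by
        rw [Ring.inverse_mul_cancel _ hT.isUnit, Ring.mul_inverse_cancel _ hT.isUnit, one_mul,
          mul_one]
  rw [geodesic_codiag, h4, mul_assoc]
  change _ * T = z
  rw [mul_assoc, Ring.inverse_mul_cancel _ hT.isUnit, mul_one]

theorem existsUnique_joins_zero {z : A} (hz : z ∈ disk A) : ∃! X : Mat A, Joins 0 z X := by
  obtain ⟨α, hα⟩ := exists_codiag hz
  refine ⟨codiag α, ⟨isHorizontal_zero_iff.2 ⟨α, rfl⟩, hα⟩, fun Y hY => ?_⟩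
  obtain ⟨β, rfl⟩ := isHorizontal_zero_iff.1 hY.1
  rw [codiag_unique (hY.2.trans hα.symm)]

/-- The exponential defining the geodesic from `0` to `z` is itself the required group element. -/
theorem exists_thetaUnitary_act_zero {z : A} (hz : z ∈ disk A) :
    ∃ g : (Mat A)ˣ, IsThetaUnitary g ∧ act (g : Mat A) 0 = z := by
  obtain ⟨α, hα⟩ := exists_codiag hz
  exact ⟨expUnit (codiag α), isThetaUnitary_expUnit (thetaAdj_codiag α), by
    rw [← hα, geodesic, one_smul]; rfl⟩

theorem existsUnique_joins {z₀ z₁ : A} (h₀ : z₀ ∈ disk A) (h₁ : z₁ ∈ disk A) :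
    ∃! X : Mat A, Joins z₀ z₁ X := by
  obtain ⟨g, hg, hg0⟩ := exists_thetaUnitary_act_zero h₀
  have hgi : act ((g⁻¹ : (Mat A)ˣ) : Mat A) z₀ = 0 := by
    rw [← hg0, act_inv_act hg zero_mem_disk]
  obtain ⟨X, hX, huniq⟩ := existsUnique_joins_zero (act_mem_disk hg.inv h₁)
  refine ⟨_, by simpa only [hg0, act_act_inv hg h₁] using hX.conj hg zero_mem_disk,
    fun Y hY => ?_⟩
  have h2 := hY.conj hg.inv h₀
  rw [hgi] at h2
  rw [← huniq _ h2]
  simp [mul_assoc]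

end Geodesics

/-! ### Endomorphisms of a line in a normalized basis. -/

theorem eq_smul_of_isNormalized {z : A} {x : line z} (hx : IsNormalized x) (y : line z) :
    y = MulOpposite.op (theta (x : Vec A) y) • x := by
  obtain ⟨h1, u, hu⟩ := hx
  have h2 : y = MulOpposite.op (((u⁻¹ : Aˣ) : A) * (y : Vec A) 0) • x := by
    ext1
    rw [Submodule.coe_smul, eq_smul_of_mem_line x.2, smul_smul, ← MulOpposite.op_mul, ← mul_assoc,
      ← hu, Units.mul_inv, one_mul]
    exact eq_smul_of_mem_line y.2
  rw [h2, Submodule.coe_smul, theta_smul_right, h1, one_mul]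

theorem endOf_apply_self {z : A} {x : line z} (hx : IsNormalized x) (a : A) :
    endOf x a x = MulOpposite.op a • x := by
  change MulOpposite.op (a * theta (x : Vec A) x) • x = _
  rw [hx.1, mul_one]

theorem matrixOf_endOf {z : A} {x : line z} (hx : IsNormalized x) (a : A) :
    matrixOf x (endOf x a) = a := by
  rw [matrixOf, endOf_apply_self hx, Submodule.coe_smul, theta_smul_right, hx.1, one_mul]

theorem smul_endOf {z : A} (x : line z) (r : ℝ) (a : A) :
    r • endOf x a = endOf x (r • a) := by
  ext y : 2
  change r • (MulOpposite.op (a * theta (x : Vec A) y) • (x : Vec A)) =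
    MulOpposite.op (r • a * theta (x : Vec A) y) • (x : Vec A)
  rw [smul_mul_assoc, MulOpposite.op_smul, smul_assoc]

theorem sqrt_norm_mul_self {p : A} (hp : IsSelfAdjoint p) : Real.sqrt ‖p * p‖ = ‖p‖ := by
  have h := CStarRing.norm_self_mul_star (x := p)
  rw [hp.star_eq] at h
  rw [h, Real.sqrt_mul_self (norm_nonneg p)]

/-- The endomorphism `e φ e⁻¹`. -/
def endConj {z w : A} (e : line z ≃ₗ[Aᵐᵒᵖ] line w) (φ : Module.End Aᵐᵒᵖ (line z)) :
    Module.End Aᵐᵒᵖ (line w) :=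
  e.toLinearMap ∘ₗ φ ∘ₗ e.symm.toLinearMap

theorem endConj_apply {z w : A} (e : line z ≃ₗ[Aᵐᵒᵖ] line w) (φ : Module.End Aᵐᵒᵖ (line z))
    (y : line w) : endConj e φ y = e (φ (e.symm y)) := rfl

/-! ### Cross ratios and parallel transport. -/

section CrossRatio

variable [PartialOrder A] [StarOrderedRing A]

/-- The isomorphism `ℓ_z → ℓ_{g · z}` given by an element `g` of `U(θ)`. -/
def lineEquiv {g : (Mat A)ˣ} (hg : IsThetaUnitary g) {z w : A} (hz : z ∈ disk A)
    (h : act (g : Mat A) z = w) : line z ≃ₗ[Aᵐᵒᵖ] line w where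
  toFun y := ⟨(g : Mat A).mulVec y, h ▸ mulVec_mem_line hg hz y.2⟩
  invFun y := ⟨((g⁻¹ : (Mat A)ˣ) : Mat A).mulVec y, by
    have h1 := mulVec_mem_line hg.inv (act_mem_disk hg hz) (show (y : Vec A) ∈ _ from h.symm ▸ y.2)
    rwa [act_inv_act hg hz] at h1⟩
  map_add' y y' := by ext1; simp [Matrix.mulVec_add]
  map_smul' a y := by ext1; exact mulVec_op_smul _ _ _
  left_inv y := by
    ext1
    simp only [Matrix.mulVec_mulVec, Units.inv_mul, Matrix.one_mulVec]
  right_inv y := by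
    ext1
    simp only [Matrix.mulVec_mulVec, Units.mul_inv, Matrix.one_mulVec]

theorem exists_isNormalized {z : A} (hz : z ∈ disk A) : ∃ x : line z, IsNormalized x := by
  obtain ⟨g, hg, h⟩ := exists_thetaUnitary_act_zero hz
  refine ⟨lineEquiv hg zero_mem_disk h ⟨![1, 0], by simp [mem_line_iff]⟩, ?_, ?_⟩
  · change theta ((g : Mat A).mulVec _) ((g : Mat A).mulVec _) = 1
    rw [hg, theta_basePt]
    simp
  · change IsUnit ((g : Mat A).mulVec ![1, 0] 0)
    rw [mulVec_basePt hg zero_mem_disk]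
    simpa using isUnit_denom hg zero_mem_disk

/-- Since `g` maps `ℓ_{g⁻¹ · z₁}` bijectively onto `ℓ_{z₁}`, the defining relation determines `φ` on
all of `ℓ_{z₁}`. -/
theorem isCrossRatio_iff {z₀ z₁ : A} (h₁ : z₁ ∈ disk A) {φ : Module.End Aᵐᵒᵖ (line z₁)} :
    IsCrossRatio z₀ z₁ φ ↔ ∃ (g : (Mat A)ˣ) (hg : IsThetaUnitary g), act (g : Mat A) 0 = z₀ ∧
      φ = endConj (lineEquiv hg (act_mem_disk hg.inv h₁) (act_act_inv hg h₁)) (crZero _) := by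
  constructor
  · rintro ⟨g, hg, h0, h⟩
    refine ⟨g, hg, h0, LinearMap.ext fun y₁ => ?_⟩
    set e := lineEquiv hg (act_mem_disk hg.inv h₁) (act_act_inv hg h₁) with he
    obtain ⟨y₂, h2, h3⟩ := h (e.symm y₁)
    have h4 : y₂ = y₁ := by
      rw [← e.apply_symm_apply y₁]; ext1; exact h2
    rw [endConj_apply]
    ext1
    rw [← h4] at h3 ⊢
    exact h3
  · rintro ⟨g, hg, h0, rfl⟩
    refine ⟨g, hg, h0, fun y => ⟨lineEquiv hg (act_mem_disk hg.inv h₁) (act_act_inv hg h₁) y,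
      rfl, ?_⟩⟩
    rw [endConj_apply, LinearEquiv.symm_apply_apply]
    rfl

/-- The parallel transport `ℓ_{z₀} → ℓ_{z₁}` along the geodesic with velocity `X`. -/
noncomputable def transportEquiv {z₀ z₁ : A} (h₀ : z₀ ∈ disk A) {X : Mat A} (h : Joins z₀ z₁ X) :
    line z₀ ≃ₗ[Aᵐᵒᵖ] line z₁ :=
  lineEquiv (isThetaUnitary_expUnit h.1.thetaAdj_eq) h₀ (by
    rw [← h.2, geodesic, one_smul]; rfl)

theorem isTransport_iff {z₀ z₁ : A} (h₀ : z₀ ∈ disk A) {X : Mat A} (h : Joins z₀ z₁ X)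
    {φ : Module.End Aᵐᵒᵖ (line z₁)} {ψ : Module.End Aᵐᵒᵖ (line z₀)} :
    IsTransport X φ ψ ↔ ψ = endConj (transportEquiv h₀ h).symm φ := by
  set e := transportEquiv h₀ h
  have key : IsTransport X φ ψ ↔ ∀ y, φ (e y) = e (ψ y) := by
    refine forall_congr' fun y => ⟨?_, fun H => ⟨e y, rfl, by rw [H]; rfl⟩⟩
    rintro ⟨y₁, h1, h2⟩
    have h3 : y₁ = e y := Subtype.ext h1
    rw [← h3]
    exact Subtype.ext h2
  rw [key, LinearMap.ext_iff]
  refine forall_congr' fun y => ?_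
  rw [endConj_apply, LinearEquiv.symm_symm, LinearEquiv.eq_symm_apply, eq_comm]

/-- In a normalized basis `x`, the cross ratio transported along the geodesic with velocity `X`
has matrix `exp (2 p)`, where `p` is the `θ`-modulus `(-θ(X x, X x))^{1/2}`. -/
theorem crossRatio_transportEquiv_apply {z₀ z₁ : A} (h₀ : z₀ ∈ disk A) (h₁ : z₁ ∈ disk A)
    {X : Mat A} (hX : Joins z₀ z₁ X) {φ : Module.End Aᵐᵒᵖ (line z₁)}
    (hφ : IsCrossRatio z₀ z₁ φ) {x : line z₀} (hx : IsNormalized x) :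
    0 ≤ -theta (X.mulVec x) (X.mulVec x) ∧
    φ (transportEquiv h₀ hX x) =
      MulOpposite.op (exp ((2 : ℝ) • CFC.sqrt (-theta (X.mulVec x) (X.mulVec x)))) •
        transportEquiv h₀ hX x := by
  obtain ⟨g, hg, h0, rfl⟩ := (isCrossRatio_iff h₁).1 hφ
  set z := act ((g⁻¹ : (Mat A)ˣ) : Mat A) z₁ with hz
  set e := lineEquiv (z := z) hg (act_mem_disk hg.inv h₁) (act_act_inv hg h₁) with he
  have hgi : act ((g⁻¹ : (Mat A)ˣ) : Mat A) z₀ = 0 := by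
    rw [← h0, act_inv_act hg zero_mem_disk]
  have hY := hX.conj hg.inv h₀
  rw [hgi, ← hz] at hY
  obtain ⟨α, hα⟩ := isHorizontal_zero_iff.1 hY.1
  have hXα : X = (g : Mat A) * codiag α * ((g⁻¹ : (Mat A)ˣ) : Mat A) := by
    rw [← hα]; simp [mul_assoc]
  rw [hα] at hY
  -- the vector `g⁻¹ x = (u, 0)`, with `u` unitary
  set e₀ := lineEquiv hg zero_mem_disk h0 with he₀
  set u : A := (e₀.symm x : Vec A) 0 with hu
  have hxu : (x : Vec A) = (g : Mat A).mulVec (MulOpposite.op u • ![1, 0]) := by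
    rw [hu, ← eq_smul_of_mem_line (e₀.symm x).2]
    exact congrArg Subtype.val (e₀.apply_symm_apply x).symm
  have hxu' : ((g⁻¹ : (Mat A)ˣ) : Mat A).mulVec x = MulOpposite.op u • ![1, 0] := by
    rw [hxu, Matrix.mulVec_mulVec, Units.inv_mul, Matrix.one_mulVec]
  have hu1 : star u * u = 1 := by
    have h := hx.1
    rw [hxu, hg, theta_smul_left, theta_smul_right, theta_basePt] at h
    simpa using h
  -- `u*u = 1` makes `u` only an isometry; the invertibility of `x₁` makes it unitary.
  have huu : IsUnit u := by
    have h := hx.2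
    rw [hxu, mulVec_op_smul, mulVec_basePt hg zero_mem_disk] at h
    obtain ⟨c, hc⟩ := isUnit_denom hg zero_mem_disk
    rw [← hc] at h
    simpa using h
  obtain ⟨v, hv⟩ := huu
  have hv1 : star u = ((v⁻¹ : Aˣ) : A) := by
    rw [← hv] at hu1 ⊢
    rw [Units.inv_eq_of_mul_eq_one_left hu1]
  have hXx : theta (X.mulVec x) (X.mulVec x) = -(star u * (star α * α) * u) := by
    rw [hXα, mul_assoc, ← Matrix.mulVec_mulVec, hg, ← Matrix.mulVec_mulVec, hxu', mulVec_op_smul,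
      theta_smul_left, theta_smul_right]
    simp [theta, codiag, mul_assoc]
  have hsqrt : CFC.sqrt (-theta (X.mulVec x) (X.mulVec x)) = star u * CFC.abs α * u := by
    refine CFC.sqrt_unique ?_ (star_left_conjugate_nonneg (CFC.abs_nonneg α) u)
    rw [hXx, neg_neg, ← CFC.abs_mul_abs, hv1, ← hv]
    simp [mul_assoc]
  refine ⟨by rw [hXx, neg_neg]; exact star_left_conjugate_nonneg (star_mul_self_nonneg α) u, ?_⟩
  have hexp : exp ((2 : ℝ) • (star u * CFC.abs α * u)) =
      star u * exp ((2 : ℝ) • CFC.abs α) * u := by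
    let _ : NormedAlgebra ℚ A := NormedAlgebra.restrictScalars ℚ ℝ A
    rw [hv1, ← hv]
    have h := exp_units_conj v⁻¹ ((2 : ℝ) • CFC.abs α)
    rw [inv_inv] at h
    rw [← h, mul_smul_comm, smul_mul_assoc]
  rw [hsqrt, hexp]
  set C := coshSqrt (star α * α) with hC
  set M := exp ((2 : ℝ) • CFC.abs α) with hM
  -- `C = cosh |α|` and `M = e^{2|α|}` are both functions of `|α|`.
  have hCM : Commute M C := by
    refine commute_coshSqrt ?_
    rw [← CFC.abs_mul_abs]
    have h : Commute M (CFC.abs α) := ((Commute.refl _).smul_left _).exp_left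
    exact h.mul_right h
  have hCz : (exp (codiag α)).mulVec ![1, 0] = MulOpposite.op C • ![1, z] := by
    have h1 : (exp (codiag α)).mulVec ![1, 0] ∈ line z := by
      rw [← hY.2, geodesic, one_smul]
      exact mulVec_mem_line (isThetaUnitary_expUnit (thetaAdj_codiag α)) zero_mem_disk
        (by simp [mem_line_iff])
    rw [eq_smul_of_mem_line h1, exp_codiag_mulVec]
    rfl
  -- This is `g⁻¹ e^X x`, because `g⁻¹ e^X g = e^{codiag α}` sends `(1, 0)u` to `(1, z)Cu`.
  set y : line z := ⟨MulOpposite.op (C * u) • ![1, z], smul_mem_line _ _⟩ with hy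
  have hEx : transportEquiv h₀ hX x = e y := by
    ext1
    change (exp X).mulVec x = (g : Mat A).mulVec (MulOpposite.op (C * u) • ![1, z])
    rw [MulOpposite.op_mul, ← smul_smul, ← hCz, ← mulVec_op_smul, ← hxu', hXα,
      matrix_exp_units_conj, Matrix.mulVec_mulVec, Matrix.mulVec_mulVec, mul_assoc]
  have hcr : crZero z y = MulOpposite.op (star u * M * u) • y := by
    ext1
    change MulOpposite.op ((1 + CFC.abs z) * Ring.inverse (1 - CFC.abs z) *
      (MulOpposite.op (C * u) • ![1, z] : Vec A) 0) • ![1, z] =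
      MulOpposite.op (star u * M * u) • MulOpposite.op (C * u) • ![1, z]
    have h2 := crossRatio_geodesic_codiag α
    rw [hY.2] at h2
    rw [h2, smul_smul, ← MulOpposite.op_mul]
    -- Multiplication by `M` on the left of the coordinate `Cu` becomes right multiplication by
    -- `u*Mu`, since `MCu = CMu = Cu(u*Mu)`.
    congr 2
    have h3 : u * star u = 1 := by rw [hv1, ← hv, Units.mul_inv]
    calc M * (MulOpposite.op (C * u) • ![1, z] : Vec A) 0 = M * C * u := by simp [mul_assoc]
      _ = C * (u * star u) * M * u := by rw [hCM.eq, h3, mul_one]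
      _ = _ := by noncomm_ring
  rw [hEx, endConj_apply, LinearEquiv.symm_apply_apply, hcr, map_smul]

/-- The value of a cross ratio on the transported basis does not involve `g`, and that basis
generates `ℓ_{z₁}`. -/
theorem isCrossRatio_unique {z₀ z₁ : A} (h₀ : z₀ ∈ disk A) (h₁ : z₁ ∈ disk A)
    {φ φ' : Module.End Aᵐᵒᵖ (line z₁)} (hφ : IsCrossRatio z₀ z₁ φ)
    (hφ' : IsCrossRatio z₀ z₁ φ') : φ = φ' := by
  obtain ⟨X, hX, -⟩ := existsUnique_joins h₀ h₁
  obtain ⟨x, hx⟩ := exists_isNormalized h₀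
  have h := (crossRatio_transportEquiv_apply h₀ h₁ hX hφ hx).2.trans
    (crossRatio_transportEquiv_apply h₀ h₁ hX hφ' hx).2.symm
  ext1 y
  rw [← (transportEquiv h₀ hX).apply_symm_apply y,
    eq_smul_of_isNormalized hx ((transportEquiv h₀ hX).symm y), map_smul, map_smul, map_smul, h]

theorem existsUnique_isCrossRatio {z₀ z₁ : A} (h₀ : z₀ ∈ disk A) (h₁ : z₁ ∈ disk A) :
    ∃! φ : Module.End Aᵐᵒᵖ (line z₁), IsCrossRatio z₀ z₁ φ := by
  obtain ⟨g, hg, h0⟩ := exists_thetaUnitary_act_zero h₀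
  exact ⟨_, (isCrossRatio_iff h₁).2 ⟨g, hg, h0, rfl⟩,
    fun φ hφ => isCrossRatio_unique h₀ h₁ hφ ((isCrossRatio_iff h₁).2 ⟨g, hg, h0, rfl⟩)⟩

theorem transport_apply {z₀ z₁ : A} (h₀ : z₀ ∈ disk A) (h₁ : z₁ ∈ disk A)
    {X : Mat A} (hX : Joins z₀ z₁ X) {φ : Module.End Aᵐᵒᵖ (line z₁)}
    (hφ : IsCrossRatio z₀ z₁ φ) {ψ : Module.End Aᵐᵒᵖ (line z₀)} (hψ : IsTransport X φ ψ)
    {x : line z₀} (hx : IsNormalized x) :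
    matrixOf x ψ = exp ((2 : ℝ) • CFC.sqrt (-theta (X.mulVec x) (X.mulVec x))) := by
  rw [matrixOf, (isTransport_iff h₀ hX).1 hψ, endConj_apply, LinearEquiv.symm_symm,
    (crossRatio_transportEquiv_apply h₀ h₁ hX hφ hx).2, map_smul, LinearEquiv.symm_apply_apply,
    Submodule.coe_smul, theta_smul_right, hx.1, one_mul]

/-- If a tangent matrix `V` satisfies `-θ(V x, V x) = p²` with `p ≥ 0`, then its modulus is the
endomorphism with matrix `p`, and its Finsler norm is `‖p‖`. -/
theorem modulus_eq_endOf {z : A} {x : line z} (hx : IsNormalized x) {V : Mat A} {p : A}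
    (hp : 0 ≤ p) (h : -theta (V.mulVec x) (V.mulVec x) = p * p) :
    modulus x V = endOf x p ∧ finslerNorm x V = ‖p‖ := by
  constructor
  · rw [modulus, sqrtEnd, innerEnd, matrixOf_endOf hx, h, CFC.sqrt_mul_self p hp]
  · rw [finslerNorm, ← norm_neg, h, sqrt_norm_mul_self (IsSelfAdjoint.of_nonneg hp)]

end CrossRatio

end PoincareDisk

theorem corollary10p2 {A : Type*} [CStarAlgebra A] [PartialOrder A] [StarOrderedRing A]
    (z₀ z₁ : A) (h₀ : z₀ ∈ PoincareDisk.disk A) (h₁ : z₁ ∈ PoincareDisk.disk A)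
    (hne : z₀ ≠ z₁) :
    -- the geodesic from `z₀` to `z₁`, the cross ratio, its parallel transport to `ℓ_{z₀}` and a
    -- normalized basis of `ℓ_{z₀}` exist; the first three are unique
    (∃! X : PoincareDisk.Mat A, PoincareDisk.Joins z₀ z₁ X) ∧
    (∃! φ : Module.End Aᵐᵒᵖ (PoincareDisk.line z₁), PoincareDisk.IsCrossRatio z₀ z₁ φ) ∧
    (∀ (X : PoincareDisk.Mat A) (φ : Module.End Aᵐᵒᵖ (PoincareDisk.line z₁)),
      PoincareDisk.Joins z₀ z₁ X → PoincareDisk.IsCrossRatio z₀ z₁ φ →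
      ∃! ψ : Module.End Aᵐᵒᵖ (PoincareDisk.line z₀), PoincareDisk.IsTransport X φ ψ) ∧
    (∃ x : PoincareDisk.line z₀, PoincareDisk.IsNormalized x) ∧
    -- the formulas
    (∀ (X : PoincareDisk.Mat A) (φ : Module.End Aᵐᵒᵖ (PoincareDisk.line z₁))
      (ψ : Module.End Aᵐᵒᵖ (PoincareDisk.line z₀)),
      PoincareDisk.Joins z₀ z₁ X → PoincareDisk.IsCrossRatio z₀ z₁ φ →
      PoincareDisk.IsTransport X φ ψ →
      -- `V` is `Log_{z₀}(z₁)`, the initial velocity of the geodesic, in the model of projections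
      ∃ V : PoincareDisk.Mat A,
        HasDerivAt (fun t : ℝ => PoincareDisk.proj (PoincareDisk.geodesic z₀ X t)) V 0 ∧
        -- `W` is the same tangent vector in the model of reflections
        ∃ W : PoincareDisk.Mat A,
          HasDerivAt (fun t : ℝ => PoincareDisk.refl (PoincareDisk.geodesic z₀ X t)) W 0 ∧
          ∀ x : PoincareDisk.line z₀, PoincareDisk.IsNormalized x →
            IsStrictlyPositive (PoincareDisk.matrixOf x ψ) ∧
            0 ≤ PoincareDisk.matrixOf x (PoincareDisk.innerEnd x V V) ∧
            PoincareDisk.modulus x V = (1 / 2 : ℝ) • PoincareDisk.logEnd x ψ ∧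
            PoincareDisk.finslerNorm x V =
              1 / 2 * PoincareDisk.normEnd x (PoincareDisk.logEnd x ψ) ∧
            PoincareDisk.modulus x W = PoincareDisk.logEnd x ψ ∧
            PoincareDisk.finslerNorm x W =
              PoincareDisk.normEnd x (PoincareDisk.logEnd x ψ)) := by
  open PoincareDisk in
  refine ⟨existsUnique_joins h₀ h₁, existsUnique_isCrossRatio h₀ h₁, fun X φ hX hφ => ?_,
    exists_isNormalized h₀, fun X φ ψ hX hφ hψ => ?_⟩
  · exact ⟨_, (isTransport_iff h₀ hX).2 rfl, fun ψ hψ => (isTransport_iff h₀ hX).1 hψ⟩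
  refine ⟨_, hasDerivAt_proj_geodesic h₀ hX.1.thetaAdj_eq, _,
    hasDerivAt_refl_geodesic h₀ hX.1.thetaAdj_eq, fun x hx => ?_⟩
  set V := X * proj z₀ - proj z₀ * X with hV
  set b := -theta (X.mulVec (x : Vec A)) (X.mulVec (x : Vec A)) with hb
  set p := CFC.sqrt b with hp
  have hVx : V.mulVec (x : Vec A) = X.mulVec (x : Vec A) := velocity_mulVec h₀ hX.1 x.2
  have hb0 : 0 ≤ b := (crossRatio_transportEquiv_apply h₀ h₁ hX hφ hx).1
  have hm : matrixOf x ψ = NormedSpace.exp ((2 : ℝ) • p) := transport_apply h₀ h₁ hX hφ hψ hx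
  have hp0 : 0 ≤ p := CFC.sqrt_nonneg b
  have hpp : p * p = b := CFC.sqrt_mul_sqrt_self b
  have h2p : 0 ≤ (2 : ℝ) • p := smul_nonneg zero_le_two hp0
  have hsa : IsSelfAdjoint ((2 : ℝ) • p) := IsSelfAdjoint.of_nonneg h2p
  have hlog : logEnd x ψ = endOf x ((2 : ℝ) • p) := by
    rw [logEnd, hm, CFC.log_exp _ hsa]
  have hnorm : normEnd x (logEnd x ψ) = ‖(2 : ℝ) • p‖ := by
    rw [normEnd, hlog, matrixOf_endOf hx]
  obtain ⟨m1, n1⟩ := modulus_eq_endOf hx (V := V) hp0 (by rw [hVx, hpp])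
  -- As `ε = 2q - 1`, the velocity of the reflections is `2V`; its modulus `2p` is exactly the
  -- logarithm of `e^{2p}`.
  obtain ⟨m2, n2⟩ := modulus_eq_endOf hx (V := 2 • V) h2p (by
    rw [Matrix.smul_mulVec, hVx, smul_mul_smul_comm, hpp, hb]
    simp only [theta, Pi.smul_apply, two_smul, mul_smul, star_add]
    norm_num
    noncomm_ring)
  refine ⟨?_, ?_, ?_, ?_, ?_, ?_⟩
  · rw [hm]
    exact ⟨hsa.exp_nonneg, ⟨⟨_, _, exp_mul_exp_neg_self _, exp_neg_mul_exp_self _⟩, rfl⟩⟩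
  · rwa [innerEnd, matrixOf_endOf hx, hVx]
  · rw [m1, hlog, smul_endOf, smul_smul]
    norm_num
  · rw [n1, hnorm, norm_smul, Real.norm_ofNat]
    ring
  · rw [m2, hlog]
  · rw [n2, hnorm]
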